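/- Let $m,n,k$ be positive integers with $k\le\min\{m,n\}$, let $A=[a_{i,j}]\in\mathbb R^{m\times n}$, let $W=[w_{i,j}]\in\mathbb R^{m\times n}$ satisfy $w_{i,j}\ge 0$ and $\sum_{i,j}w_{i,j}=1$, and let $\lambda>0$. Let $V_k(\mathbb R^n)=\{X\in\mathbb R^{n\times k} : X^TX=I_k\}$ be the Stiefel manifold and let $M=V_k(\mathbb R^m)\times\mathbb R^k\times V_k(\mathbb R^n)$, a Riemannian submanifold of the Euclidean space $\mathbb R^{m\times k}\times\mathbb R^k\times\mathbb R^{n\times k}$. Define $G:M\to\mathbb R$ by $$G(U,\mathbf x,V)=F\big(U\,\mathrm{diag}(\mathbf x)\,V^T\big),\qquad F(P)=\sum_{i=1}^m\sum_{j=1}^n w_{i,j}(a_{i,j}-p_{i,j})^2+\lambda\|P\|_F^2 ,$$ and let $\nabla G$ be its Riemannian gradient and $\langle\cdot,\cdot\rangle$, $\|\cdot\|$ the inner product and norm induced from the Euclidean space. For a matrix $C$ with linearly independent columns let $\mathrm{qf}(C)$ be the factor $Q$ in the decomposition $C=QR$ in which $Q$ has orthonormal columns and $R$ is upper triangular with positive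 diagonal entries. For $p=(U,\mathbf x,V)\in M$ and a tangent vector $(Y,\hat{\mathbf x},Z)\in T_pM$ put $$R_{(U,\mathbf x,V)}(Y,\hat{\mathbf x},Z)=\big(\mathrm{qf}(U+Y),\ \mathbf x+\hat{\mathbf x},\ \mathrm{qf}(V+Z)\big).$$ Fix $\overline\alpha>0$ and $\beta,\iota\in(0,1)$. For $p\in M$ and $\eta\in T_pM$, the Armijo step size of $\eta$ at $p$ is $\beta^N\overline\alpha$, where $N$ is the smallest non-negative integer with $$G(p)-G\big(R_p(\beta^N\overline\alpha\,\eta)\big)\ \ge\ -\iota\,\big\langle\nabla G(p),\beta^N\overline\alpha\,\eta\big\rangle .$$ Let $p_t=(U_t,\mathbf x_t,V_t)$, $t=0,1,2,\dots$, be a sequence in $M$, with arbitrary initial iterate $p_0\in M$, such that for every $t\ge 0$ $$G(p_t)-G(p_{t+1})\ \ge\ G(p_t)-G\big(R_{p_t}(-\tau^A_t\nabla G(p_t))\big),$$ where $\tau^A_t$ is the Armijo step size of $-\nabla G(p_t)$ at $p_t$. Then $\lim_{t\to\infty}\|\nabla G(U_t,\mathbf x_t,V_t)\|=0$, and $\{(U_t,\mathbf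 x_t,V_t)\}$ has a subsequence that converges to a critical point of $G$ in $M$ (a point of $M$ where $\nabla G=0$). -/

import Mathlib

open Filter Topology

noncomputable section

/-! ### The Q-factor of a matrix with linearly independent columns -/

/-- `Q` is the orthonormal factor in a decomposition `C = Q * R` where `Q` has orthonormal columns
and `R` is upper triangular with positive diagonal entries. -/
def IsQFactor {m k : ℕ} (C Q : Matrix (Fin m) (Fin k) ℝ) : Prop :=
  Q.transpose * Q = 1 ∧
    ∃ R : Matrix (Fin k) (Fin k) ℝ,
      (∀ i j, j < i → R i j = 0) ∧ (∀ i, 0 < R i i) ∧ C = Q * R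

/-- A matrix with linearly independent columns has a `QR` decomposition. -/
theorem exists_isQFactor {m k : ℕ} {C : Matrix (Fin m) (Fin k) ℝ}
    (hC : LinearIndependent ℝ C.transpose) : ∃ Q, IsQFactor C Q := by
  let c : Fin k → EuclideanSpace ℝ (Fin m) := fun j => WithLp.toLp 2 (C.transpose j)
  have hc : LinearIndependent ℝ c :=
    hC.map' (WithLp.linearEquiv 2 ℝ (Fin m → ℝ)).symm.toLinearMap (LinearEquiv.ker _)
  let g := InnerProductSpace.gramSchmidt ℝ c
  let q := InnerProductSpace.gramSchmidtNormed ℝ c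
  have hq : Orthonormal ℝ q := InnerProductSpace.gramSchmidtNormed_orthonormal hc
  have hg : ∀ j, 0 < ‖g j‖ := fun j =>
    norm_pos_iff.2 (InnerProductSpace.gramSchmidt_ne_zero j hc)
  have hgq : ∀ j, g j = ‖g j‖ • q j := by
    intro j
    have h : q j = (‖g j‖)⁻¹ • g j := rfl
    rw [h, smul_smul, mul_inv_cancel₀ (hg j).ne', one_smul]
  let R : Matrix (Fin k) (Fin k) ℝ := Matrix.of fun i j =>
    if i < j then (inner ℝ (g i) (c j) / ‖g i‖ ^ 2) * ‖g i‖ else if i = j then ‖g j‖ else 0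
  refine ⟨Matrix.of fun i l => q l i, ?_, R, ?_, ?_, ?_⟩
  · ext a b
    have := orthonormal_iff_ite.1 hq a b
    simp only [Matrix.mul_apply, Matrix.transpose_apply, Matrix.one_apply, Matrix.of_apply]
    rw [← this, PiLp.inner_apply]
    simp [mul_comm]
  · intro i j hij
    simp [R, not_lt.2 hij.le, hij.ne']
  · intro i
    simpa [R] using hg i
  · have key : ∀ j, c j = ∑ l, R l j • q l := by
      intro j
      have h := InnerProductSpace.gramSchmidt_def'' ℝ c j
      have h1 : ∑ l, R l j • q l
          = ∑ l, ((if l = j then ‖g j‖ • q j else 0) +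
              if l < j then (inner ℝ (g l) (c j) / ‖g l‖ ^ 2) • g l else 0) := by
        refine Finset.sum_congr rfl fun l _ => ?_
        rcases lt_trichotomy l j with h | h | h
        · simp only [R, Matrix.of_apply, h, if_true, h.ne, if_false, zero_add]
          conv_rhs => rw [hgq l]
          rw [smul_smul, hgq l]
          simp [norm_smul, hq.1 l]
        · subst h; simp [R]
        · simp [R, not_lt.2 h.le, h.ne']
      rw [h1, Finset.sum_add_distrib, Finset.sum_ite_eq' Finset.univ j, ← Finset.sum_filter]
      simp only [Finset.mem_univ, if_true, ← hgq j]
      rw [show Finset.univ.filter (fun l => l < j) = Finset.Iio j by ext l; simp]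
      exact h
    ext i j
    have := congrArg (fun v : EuclideanSpace ℝ (Fin m) => v i) (key j)
    simp only [c, Matrix.transpose_apply] at this
    rw [this, Matrix.mul_apply]
    simp [mul_comm]

/-- The orthonormal factor of a `QR` decomposition is unique. -/
theorem isQFactor_unique {m k : ℕ} {C Q Q' : Matrix (Fin m) (Fin k) ℝ}
    (h : IsQFactor C Q) (h' : IsQFactor C Q') : Q = Q' := by
  obtain ⟨hQ, R, hR, hRp, hC⟩ := h
  obtain ⟨hQ', R', hR', hRp', hC'⟩ := h'
  have hT : R.IsUpperTriangular := fun i j hij => hR i j hij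
  have hT' : R'.IsUpperTriangular := fun i j hij => hR' i j hij
  have hdet : IsUnit R.det := by
    rw [Matrix.det_of_isUpperTriangular hT]
    exact (Finset.prod_pos fun i _ => hRp i).ne'.isUnit
  let _ : Invertible R := Matrix.invertibleOfIsUnitDet R hdet
  have hTi : (R⁻¹).IsUpperTriangular := Matrix.blockTriangular_inv_of_blockTriangular hT
  have hdiag : ∀ i, 0 < R⁻¹ i i := by
    intro i
    have h1 : (R * R⁻¹) i i = 1 := by rw [Matrix.mul_nonsing_inv R hdet]; simp
    rw [Matrix.mul_apply, Finset.sum_eq_single i] at h1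
    · have := hRp i
      by_contra hn
      nlinarith
    · intro j _ hj
      rcases lt_or_gt_of_ne hj with h | h
      · rw [hR i j h, zero_mul]
      · rw [hTi h, mul_zero]
    · simp
  set S := R' * R⁻¹ with hS
  have hST : S.IsUpperTriangular := Matrix.BlockTriangular.mul hT' hTi
  have hSp : ∀ i, 0 < S i i := by
    intro i
    rw [hS, Matrix.mul_apply, Finset.sum_eq_single i]
    · exact mul_pos (hRp' i) (hdiag i)
    · intro j _ hj
      rcases lt_or_gt_of_ne hj with h | h
      · rw [hR' i j h, zero_mul]
      · rw [hTi h, mul_zero]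
    · simp
  have hQS : Q = Q' * S := by
    rw [hS, ← Matrix.mul_assoc, ← hC', hC, Matrix.mul_assoc, Matrix.mul_nonsing_inv R hdet,
      Matrix.mul_one]
  have hSS : S.transpose * S = 1 := by
    rw [hQS, Matrix.transpose_mul, Matrix.mul_assoc, ← Matrix.mul_assoc Q'.transpose, hQ',
      Matrix.one_mul] at hQ
    exact hQ
  have hSdet : IsUnit S.det := Matrix.isUnit_det_of_left_inverse hSS
  let _ : Invertible S := Matrix.invertibleOfIsUnitDet S hSdet
  have hSi : S⁻¹ = S.transpose := Matrix.inv_eq_left_inv hSS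
  have hTS : (S⁻¹).IsUpperTriangular := Matrix.blockTriangular_inv_of_blockTriangular hST
  have hoff : ∀ i j, i ≠ j → S i j = 0 := by
    intro i j hij
    rcases lt_or_gt_of_ne hij with h | h
    · have := hTS h
      rwa [hSi] at this
    · exact hST h
  have hS1 : S = 1 := by
    ext i j
    by_cases hij : i = j
    · subst hij
      have h1 : (S.transpose * S) i i = 1 := by rw [hSS]; simp
      rw [Matrix.mul_apply, Finset.sum_eq_single i] at h1
      · have := hSp i
        simp only [Matrix.transpose_apply] at h1
        rw [Matrix.one_apply_eq]
        nlinarith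
      · intro j _ hj
        rw [hoff j i hj, mul_zero]
      · simp
    · rw [hoff i j hij, Matrix.one_apply_ne hij]
  rw [hQS, hS1, Matrix.mul_one]

open Classical in
/-- `qf C` is the factor `Q` in the `QR` decomposition of a matrix `C` with linearly independent
columns (and `0` for all other matrices). -/
def qf {m k : ℕ} (C : Matrix (Fin m) (Fin k) ℝ) : Matrix (Fin m) (Fin k) ℝ :=
  if h : LinearIndependent ℝ C.transpose then (exists_isQFactor h).choose else 0

/-! ### Riemannian submanifolds of a Euclidean space -/

section Submanifold

variable {E : Type*} [NormedAddCommGroup E] [InnerProductSpace ℝ E] [FiniteDimensional ℝ E]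

/-- The tangent space at `p` of a submanifold `M` of a Euclidean space `E`, as a linear subspace
of `E`. -/
def tangentSubspace (M : Set E) (p : E) : Submodule ℝ E :=
  Submodule.span ℝ (tangentConeAt ℝ M p)

/-- The Riemannian gradient at `p` of the restriction of `f` to the submanifold `M` of `E`, with
the metric induced from `E`: the tangent vector that represents the differential of `f` along `M`.
Derivatives of `f` within `M` agree on tangent vectors, so that this depends only on the values of
`f` on `M`. -/
def riemannianGradient (f : E → ℝ) (M : Set E) (p : E) : E :=
  (tangentSubspace M p).starProjection (gradientWithin f M p)

/-- The differential of the restriction of `f` to `M`, at a point where `f` is differentiable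
within `M`, is the inner product with the Riemannian gradient. -/
theorem inner_riemannianGradient {f : E → ℝ} {M : Set E} {p : E} {f' : E →L[ℝ] ℝ}
    (hf : HasFDerivWithinAt f f' M p) {v : E} (hv : v ∈ tangentSubspace M p) :
    inner ℝ (riemannianGradient f M p) v = f' v := by
  have h1 : inner ℝ (riemannianGradient f M p) v = fderivWithin ℝ f M p v := by
    rw [riemannianGradient, Submodule.inner_starProjection_left_eq_right,
      Submodule.starProjection_eq_self_iff.2 hv, gradientWithin,
      InnerProductSpace.toDual_symm_apply]
  rw [h1]
  have h2 : Set.EqOn (fderivWithin ℝ f M p) f' (tangentConeAt ℝ M p) :=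
    hf.differentiableWithinAt.hasFDerivWithinAt.unique_on hf
  exact LinearMap.eqOn_span (f := (fderivWithin ℝ f M p).toLinearMap) (g := f'.toLinearMap) h2 hv

/-- The exponent `N` is admissible for the Armijo rule at the point `p` and the tangent vector
`η`: the retraction `R` along `β ^ N * αbar • η` decreases `f` sufficiently. -/
def ArmijoCondition (f : E → ℝ) (M : Set E) (R : E → E → E) (αbar β ι : ℝ) (p η : E) (N : ℕ) :
    Prop :=
  f p - f (R p ((β ^ N * αbar) • η)) ≥
    -ι * inner ℝ (riemannianGradient f M p) ((β ^ N * αbar) • η)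

/-- The Armijo step size `β ^ N * αbar`, where `N` is the smallest admissible exponent. -/
def armijoStepSize (f : E → ℝ) (M : Set E) (R : E → E → E) (αbar β ι : ℝ) (p η : E) : ℝ :=
  β ^ sInf {N : ℕ | ArmijoCondition f M R αbar β ι p η N} * αbar

/-- `z` is a sequence of iterates in `M` of the accelerated line search for `f` along the negative
gradient: each step decreases `f` at least as much as the Armijo step does. -/
def IsAcceleratedLineSearch (f : E → ℝ) (M : Set E) (R : E → E → E) (αbar β ι : ℝ) (z : ℕ → E) :
    Prop :=
  (∀ t, z t ∈ M) ∧
    ∀ t, f (z t) - f (z (t + 1)) ≥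
      f (z t) - f (R (z t)
        (-(armijoStepSize f M R αbar β ι (z t) (-riemannianGradient f M (z t)) •
          riemannianGradient f M (z t))))

end Submanifold

/-! ### The regularized weighted low-rank approximation problem -/

/-- The Euclidean space `ℝ^{m × k} × ℝ^k × ℝ^{n × k}` of triples `(U, x, V)`, with the inner
product `⟨(U, x, V), (U', x', V')⟩ = ∑ U i l * U' i l + ∑ x l * x' l + ∑ V j l * V' j l`. -/
abbrev TripleSpace (m n k : ℕ) : Type :=
  EuclideanSpace ℝ ((Fin m × Fin k) ⊕ Fin k ⊕ (Fin n × Fin k))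

namespace TripleSpace

variable {m n k : ℕ}

/-- The component `U` of `(U, x, V)`. -/
def U (z : TripleSpace m n k) : Matrix (Fin m) (Fin k) ℝ :=
  Matrix.of fun i l => z (Sum.inl (i, l))

/-- The component `x` of `(U, x, V)`. -/
def x (z : TripleSpace m n k) : Fin k → ℝ :=
  fun l => z (Sum.inr (Sum.inl l))

/-- The component `V` of `(U, x, V)`. -/
def V (z : TripleSpace m n k) : Matrix (Fin n) (Fin k) ℝ :=
  Matrix.of fun j l => z (Sum.inr (Sum.inr (j, l)))

/-- The triple `(U, x, V)`. -/
def mk (U : Matrix (Fin m) (Fin k) ℝ) (x : Fin k → ℝ) (V : Matrix (Fin n) (Fin k) ℝ) :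
    TripleSpace m n k :=
  WithLp.toLp 2 (Sum.elim (fun a => U a.1 a.2) (Sum.elim x fun b => V b.1 b.2))

end TripleSpace

/-- The Stiefel manifold `V_k(ℝ^n)` of `n × k` matrices with orthonormal columns. -/
def stiefel (n k : ℕ) : Set (Matrix (Fin n) (Fin k) ℝ) :=
  {X | X.transpose * X = 1}

/-- The submanifold `V_k(ℝ^m) × ℝ^k × V_k(ℝ^n)` of `ℝ^{m × k} × ℝ^k × ℝ^{n × k}`. -/
def stiefelProduct (m n k : ℕ) : Set (TripleSpace m n k) :=
  {z | z.U ∈ stiefel m k ∧ z.V ∈ stiefel n k}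

/-- The map `R_{(U, x, V)}(Y, y, Z) = (qf (U + Y), x + y, qf (V + Z))`, which on tangent vectors
is the `QR` retraction of `V_k(ℝ^m) × ℝ^k × V_k(ℝ^n)`. -/
def qrRetraction {m n k : ℕ} (z v : TripleSpace m n k) : TripleSpace m n k :=
  TripleSpace.mk (qf (z.U + v.U)) (z.x + v.x) (qf (z.V + v.V))

/-- The Frobenius norm of a matrix. -/
def frobNorm {m n : ℕ} (P : Matrix (Fin m) (Fin n) ℝ) : ℝ :=
  Real.sqrt (∑ i, ∑ j, P i j ^ 2)

/-- The regularized cost `F(P) = ∑ w i j (a i j - p i j) ^ 2 + lam ‖P‖_F ^ 2`. -/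
def costF {m n : ℕ} (A W : Matrix (Fin m) (Fin n) ℝ) (lam : ℝ) (P : Matrix (Fin m) (Fin n) ℝ) :
    ℝ :=
  (∑ i, ∑ j, W i j * (A i j - P i j) ^ 2) + lam * frobNorm P ^ 2

/-- The function `G(U, x, V) = F(U D(x) Vᵀ)`, where `D(x)` is the diagonal matrix with diagonal
`x`. -/
def costG {m n k : ℕ} (A W : Matrix (Fin m) (Fin n) ℝ) (lam : ℝ) (z : TripleSpace m n k) : ℝ :=
  costF A W lam (z.U * Matrix.diagonal z.x * z.V.transpose)

end

/-! The QR retraction agrees with `p + v` up to second order, uniformly on all of `M`. If `Y` is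
tangent at `U`, then `(U + Y)ᵀ(U + Y) = 1 + YᵀY`, so the triangular factor `R` of `U + Y = QR` is
the Cholesky factor of `1 + YᵀY`. Since `Q - U - Y = -Q(R - 1)`, the error has the Frobenius norm of
`R - 1`, which is `O(‖Y‖²)` (`sum_sq_sub_one_le_of_transpose_mul_self_eq`).

The cost is a polynomial, so on bounded parts of `M` Taylor expansion gives `G(R_p v) ≤ G(p) +
⟨∇G(p), v⟩ + C‖v‖²` with one constant `C`. Hence every step size below some fixed `σ` passes the
Armijo test, backtracking never goes below `min ᾱ (βσ)`, and each step gains at least `δ‖∇G‖²`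
(`exists_armijo_decrease`).

On `M` the Frobenius norm of `U diag(x) Vᵀ` is `‖x‖`, so `λ‖x‖² ≤ G` and sublevel sets are bounded.
The gains telescope against the lower bound `0`, so `∇G → 0`. As `M` is closed, a subsequence
converges in `M`; its limit is critical because the tangent projections depend continuously on the
point. -/

noncomputable section

/-! ### Tangent vectors from retraction curves -/

section TangentVectors

variable {E : Type*} [NormedAddCommGroup E] [InnerProductSpace ℝ E]

/-- A curve `t ↦ R (t • v)` in `M` with `R (t • v) = p + t • v + O(t ^ 2)` shows that `v` is
tangent to `M` at `p`. -/
theorem mem_tangentSubspace_of_retraction {M : Set E} {p v : E} {R : E → E} {c : ℝ}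
    (hM : ∀ t : ℝ, R (t • v) ∈ M)
    (hR : ∀ t : ℝ, ‖R (t • v) - p - t • v‖ ≤ c * ‖t • v‖ ^ 2) :
    v ∈ tangentSubspace M p := by
  refine Submodule.subset_span ?_
  -- At parameter `1/(n+1)`, rescaling by `n+1` leaves an error of at most `c‖v‖²/(n+1)`.
  set d : ℕ → E := fun n => R (((n : ℝ) + 1)⁻¹ • v) - p with hd
  have hinv : Tendsto (fun n : ℕ => ((n : ℝ) + 1)⁻¹) atTop (𝓝 0) := by
    simpa [one_div] using tendsto_one_div_add_atTop_nhds_zero_nat (𝕜 := ℝ)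
  have hcd : Tendsto (fun n : ℕ => ((n : ℝ) + 1) • d n) atTop (𝓝 v) := by
    rw [tendsto_iff_norm_sub_tendsto_zero]
    have hlim : Tendsto (fun n : ℕ => c * ‖v‖ ^ 2 * ((n : ℝ) + 1)⁻¹) atTop (𝓝 0) := by
      simpa using hinv.const_mul (c * ‖v‖ ^ 2)
    refine squeeze_zero (fun _ => norm_nonneg _) (fun n => ?_) hlim
    have hn : (0 : ℝ) < (n : ℝ) + 1 := by positivity
    have h1 : ((n : ℝ) + 1) • d n - v
        = ((n : ℝ) + 1) • (R (((n : ℝ) + 1)⁻¹ • v) - p - ((n : ℝ) + 1)⁻¹ • v) := by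
      rw [smul_sub _ _ (((n : ℝ) + 1)⁻¹ • v), smul_smul, mul_inv_cancel₀ hn.ne', one_smul]
    have h2 := hR ((n : ℝ) + 1)⁻¹
    rw [norm_smul ((n : ℝ) + 1)⁻¹, Real.norm_of_nonneg (inv_pos.2 hn).le] at h2
    rw [h1, norm_smul, Real.norm_of_nonneg hn.le]
    calc _ ≤ ((n : ℝ) + 1) * (c * (((n : ℝ) + 1)⁻¹ * ‖v‖) ^ 2) := by gcongr
      _ = _ := by field_simp
  refine mem_tangentConeAt_of_seq atTop (fun n : ℕ => (n : ℝ) + 1) d ?_ ?_ hcd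
  · have h := hinv.smul hcd
    rw [zero_smul] at h
    refine h.congr fun n => ?_
    have hn : (n : ℝ) + 1 ≠ 0 := by positivity
    rw [smul_smul, inv_mul_cancel₀ hn, one_smul]
  · exact Eventually.of_forall fun n => by simpa [hd] using hM _

end TangentVectors

/-! ### Convergence of the line search for a second-order retraction -/

section LineSearch

variable {E : Type*} [NormedAddCommGroup E] [InnerProductSpace ℝ E] [FiniteDimensional ℝ E]

theorem riemannianGradient_mem_tangentSubspace (f : E → ℝ) (M : Set E) (p : E) :
    riemannianGradient f M p ∈ tangentSubspace M p :=
  Submodule.starProjection_apply_mem _ _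

/-- On a ball, a twice continuously differentiable function has bounded derivative and differs from
its first order Taylor polynomial by a quadratic term. -/
theorem exists_abs_sub_fderiv_le_sq {f : E → ℝ} (hf : ContDiff ℝ 2 f) (ρ : ℝ) :
    ∃ C L : ℝ, 0 ≤ C ∧ 0 ≤ L ∧ (∀ p ∈ Metric.closedBall (0 : E) ρ, ‖fderiv ℝ f p‖ ≤ L) ∧
      ∀ p ∈ Metric.closedBall (0 : E) ρ, ∀ q ∈ Metric.closedBall (0 : E) ρ,
        |f q - f p - fderiv ℝ f p (q - p)| ≤ C * ‖q - p‖ ^ 2 := by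
  have hf1 : ContDiff ℝ 1 (fderiv ℝ f) := hf.fderiv_right (by norm_num)
  have hcomp : IsCompact (Metric.closedBall (0 : E) ρ) := isCompact_closedBall _ _
  obtain ⟨L, hL⟩ := hcomp.exists_bound_of_continuousOn (hf1.continuous.continuousOn)
  obtain ⟨K, hK⟩ := hcomp.exists_bound_of_continuousOn
    ((hf1.continuous_fderiv one_ne_zero).continuousOn)
  refine ⟨max K 0, max L 0, le_max_right _ _, le_max_right _ _,
    fun p hp => (hL p hp).trans (le_max_left _ _), fun p hp q hq => ?_⟩
  have hseg : segment ℝ p q ⊆ Metric.closedBall (0 : E) ρ :=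
    (convex_closedBall _ _).segment_subset hp hq
  -- The bound `K` on the second derivative makes `fderiv` Lipschitz; a second mean value estimate,
  -- for `f` minus its linear part, then yields the quadratic remainder.
  have hbound : ∀ x ∈ segment ℝ p q, ‖fderiv ℝ f x - fderiv ℝ f p‖ ≤ max K 0 * ‖q - p‖ := by
    intro x hx
    refine ((convex_closedBall (0 : E) ρ).norm_image_sub_le_of_norm_fderiv_le (𝕜 := ℝ)
      (fun y _ => (hf1.differentiable one_ne_zero) y)
      (fun y hy => (hK y hy).trans (le_max_left K 0)) hp (hseg hx)).trans ?_
    gcongr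
    exact norm_sub_le_of_mem_segment hx
  have h := (convex_segment p q).norm_image_sub_le_of_norm_fderiv_le' (𝕜 := ℝ)
    (fun y _ => (hf.differentiable two_ne_zero) y) hbound
    (left_mem_segment ℝ p q) (right_mem_segment ℝ p q)
  rw [Real.norm_eq_abs] at h
  calc _ ≤ _ := h
    _ = _ := by ring

/-- Along a retraction that is tangent to second order, a twice continuously differentiable
function is bounded above by its first order Taylor polynomial plus a quadratic term, uniformly on
bounded parts of `M`. -/
theorem exists_retraction_le {f : E → ℝ} (hf : ContDiff ℝ 2 f) {M : Set E} {R : E → E → E} {c : ℝ}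
    (hc : 0 ≤ c)
    (hR : ∀ p ∈ M, ∀ v ∈ tangentSubspace M p, ‖R p v - p - v‖ ≤ c * ‖v‖ ^ 2) (ρ : ℝ) :
    ∃ C L : ℝ, 0 ≤ C ∧ 0 ≤ L ∧ ∀ p ∈ M, ‖p‖ ≤ ρ → ‖riemannianGradient f M p‖ ≤ L ∧
      ∀ v ∈ tangentSubspace M p, ‖v‖ ≤ 1 →
        f (R p v) ≤ f p + inner ℝ (riemannianGradient f M p) v + C * ‖v‖ ^ 2 := by
  -- For `‖v‖ ≤ 1` the retracted point is within `1 + c` of `p`, hence the enlarged radius.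
  obtain ⟨C, L, hC, hL, hLb, hCb⟩ := exists_abs_sub_fderiv_le_sq hf (ρ + (1 + c))
  -- `L * c` pays for applying the derivative to the retraction error, `C * (1 + c) ^ 2` for the
  -- Taylor remainder at `R p v`.
  refine ⟨L * c + C * (1 + c) ^ 2, L, by positivity, hL, fun p hp hpρ => ?_⟩
  have hpb : p ∈ Metric.closedBall (0 : E) (ρ + (1 + c)) := by
    rw [mem_closedBall_zero_iff]; linarith
  have hgr : ∀ v ∈ tangentSubspace M p,
      inner ℝ (riemannianGradient f M p) v = fderiv ℝ f p v := fun v hv =>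
    inner_riemannianGradient ((hf.differentiable two_ne_zero) p).hasFDerivAt.hasFDerivWithinAt hv
  refine ⟨?_, fun v hv hv1 => ?_⟩
  · set g := riemannianGradient f M p with hg
    have h1 : ‖g‖ * ‖g‖ ≤ L * ‖g‖ := by
      rw [← real_inner_self_eq_norm_mul_norm, hgr g (riemannianGradient_mem_tangentSubspace f M p)]
      exact (le_abs_self _).trans (((fderiv ℝ f p).le_opNorm g).trans
        (mul_le_mul_of_nonneg_right (hLb p hpb) (norm_nonneg _)))
    by_contra hlt
    push Not at hlt
    exact absurd h1 (not_le.2 (mul_lt_mul_of_pos_right hlt (hL.trans_lt hlt)))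
  · have h1 := hR p hp v hv
    have hv2 : ‖v‖ ^ 2 ≤ ‖v‖ := by nlinarith [norm_nonneg v]
    have h2 : ‖R p v - p‖ ≤ (1 + c) * ‖v‖ := by
      calc ‖R p v - p‖ = ‖v + (R p v - p - v)‖ := by congr 1; abel
        _ ≤ ‖v‖ + c * ‖v‖ ^ 2 := (norm_add_le _ _).trans (by gcongr)
        _ ≤ ‖v‖ + c * ‖v‖ := by gcongr
        _ = _ := by ring
    have hqb : R p v ∈ Metric.closedBall (0 : E) (ρ + (1 + c)) := by
      rw [mem_closedBall_zero_iff]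
      calc ‖R p v‖ = ‖p + (R p v - p)‖ := by congr 1; abel
        _ ≤ ‖p‖ + (1 + c) * ‖v‖ := (norm_add_le _ _).trans (by gcongr)
        _ ≤ ρ + (1 + c) * 1 := by gcongr
        _ = _ := by ring
    have h3 := le_of_abs_le (hCb p hpb _ hqb)
    have h4 : fderiv ℝ f p (R p v - p)
        = inner ℝ (riemannianGradient f M p) v + fderiv ℝ f p (R p v - p - v) := by
      rw [hgr v hv, ← map_add]; congr 1; abel
    have h5 : fderiv ℝ f p (R p v - p - v) ≤ L * (c * ‖v‖ ^ 2) :=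
      (le_abs_self _).trans (((fderiv ℝ f p).le_opNorm _).trans
        (mul_le_mul (hLb p hpb) h1 (norm_nonneg _) hL))
    have h6 : C * ‖R p v - p‖ ^ 2 ≤ C * ((1 + c) * ‖v‖) ^ 2 := by gcongr
    nlinarith

/-- On bounded parts of `M`, the Armijo step decreases `f` by at least a fixed multiple of the
squared norm of the gradient. -/
theorem exists_armijo_decrease {f : E → ℝ} (hf : ContDiff ℝ 2 f) {M : Set E} {R : E → E → E}
    {c : ℝ} (hc : 0 ≤ c)
    (hR : ∀ p ∈ M, ∀ v ∈ tangentSubspace M p, ‖R p v - p - v‖ ≤ c * ‖v‖ ^ 2)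
    {αbar β ι : ℝ} (hα : 0 < αbar) (hβ0 : 0 < β) (hβ1 : β < 1) (hι0 : 0 < ι) (hι1 : ι < 1)
    (ρ : ℝ) :
    ∃ δ : ℝ, 0 < δ ∧ ∀ p ∈ M, ‖p‖ ≤ ρ → δ * ‖riemannianGradient f M p‖ ^ 2 ≤
      f p - f (R p (-(armijoStepSize f M R αbar β ι p (-riemannianGradient f M p) •
          riemannianGradient f M p))) := by
  obtain ⟨C, L, hC, hL, hCL⟩ := exists_retraction_le hf hc hR ρ
  -- The first term keeps `‖τg‖ ≤ 1`, the second gives `τC ≤ 1 - ι`; the added ones avoid division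
  -- by zero.
  set σ := min (1 / (L + 1)) ((1 - ι) / (C + 1)) with hσ
  have hσ0 : 0 < σ := lt_min (by positivity) (div_pos (by linarith) (by positivity))
  have hσL : σ * L ≤ 1 := by
    have h : σ * (L + 1) ≤ 1 := (le_div_iff₀ (by positivity)).1 (min_le_left _ _)
    nlinarith
  have hσC : σ * C ≤ 1 - ι := by
    have h : σ * (C + 1) ≤ 1 - ι := (le_div_iff₀ (by positivity)).1 (min_le_right _ _)
    nlinarith
  refine ⟨ι * min αbar (β * σ), by positivity, fun p hp hpρ => ?_⟩
  obtain ⟨hgL, hdesc⟩ := hCL p hp hpρ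
  set g := riemannianGradient f M p with hg
  have hgT : g ∈ tangentSubspace M p := riemannianGradient_mem_tangentSubspace f M p
  have hcond : ∀ N, ArmijoCondition f M R αbar β ι p (-g) N ↔
      ι * (β ^ N * αbar) * ‖g‖ ^ 2 ≤ f p - f (R p ((β ^ N * αbar) • -g)) := by
    intro N
    rw [ArmijoCondition, ← hg, inner_smul_right, inner_neg_right, real_inner_self_eq_norm_sq,
      ge_iff_le]
    ring_nf
  have hsmall : ∀ N, β ^ N * αbar ≤ σ → ArmijoCondition f M R αbar β ι p (-g) N := by
    intro N hN
    rw [hcond]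
    set τ := β ^ N * αbar with hτ
    have hτ0 : 0 < τ := by positivity
    have hnorm : ‖τ • -g‖ = τ * ‖g‖ := by
      rw [norm_smul, norm_neg, Real.norm_of_nonneg hτ0.le]
    have h := hdesc (τ • -g) (Submodule.smul_mem _ _ (Submodule.neg_mem _ hgT)) (by
      rw [hnorm]
      exact (mul_le_mul hN hgL (norm_nonneg _) hσ0.le).trans hσL)
    rw [hnorm, inner_smul_right, inner_neg_right, real_inner_self_eq_norm_sq] at h
    have h1 : τ * C ≤ 1 - ι := (mul_le_mul_of_nonneg_right hN hC).trans hσC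
    have h2 : 0 ≤ τ * ‖g‖ ^ 2 * (1 - ι - τ * C) :=
      mul_nonneg (by positivity) (by linarith)
    nlinarith
  obtain ⟨N₀, hN₀⟩ := exists_pow_lt_of_lt_one (div_pos hσ0 hα) hβ1
  -- Without an admissible exponent, `sInf` would be the default value `0`.
  have hne : {N : ℕ | ArmijoCondition f M R αbar β ι p (-g) N}.Nonempty :=
    ⟨N₀, hsmall N₀ ((lt_div_iff₀ hα).1 hN₀).le⟩
  set N := sInf {N : ℕ | ArmijoCondition f M R αbar β ι p (-g) N} with hN
  have hstep : armijoStepSize f M R αbar β ι p (-g) = β ^ N * αbar := rfl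
  have hge : min αbar (β * σ) ≤ β ^ N * αbar := by
    rcases Nat.eq_zero_or_pos N with h0 | hpos
    · rw [h0, pow_zero, one_mul]; exact min_le_left _ _
    · obtain ⟨K, hK⟩ := Nat.exists_eq_succ_of_ne_zero hpos.ne'
      -- By minimality the previous exponent fails, so its step size exceeds `σ`, and one more
      -- factor `β` costs no more than `βσ`.
      have hnot : ¬ ArmijoCondition f M R αbar β ι p (-g) K := fun h => by
        have := Nat.sInf_le (s := {N : ℕ | ArmijoCondition f M R αbar β ι p (-g) N}) h
        omega
      have hlt : σ < β ^ K * αbar := lt_of_not_ge fun h => hnot (hsmall K h)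
      rw [hK, pow_succ]
      refine (min_le_right _ _).trans ?_
      nlinarith
  have hA : ι * (β ^ N * αbar) * ‖g‖ ^ 2 ≤ f p - f (R p ((β ^ N * αbar) • -g)) :=
    (hcond N).1 (Nat.sInf_mem hne)
  rw [hstep, ← smul_neg]
  refine le_trans ?_ hA
  gcongr

/-- An accelerated line search on a set with bounded sublevel sets stays in a bounded set, and the
Riemannian gradient tends to zero along it. -/
theorem IsAcceleratedLineSearch.bounded_and_tendsto {f : E → ℝ} (hf : ContDiff ℝ 2 f)
    {M : Set E} {R : E → E → E} {c : ℝ} (hc : 0 ≤ c)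
    (hR : ∀ p ∈ M, ∀ v ∈ tangentSubspace M p, ‖R p v - p - v‖ ≤ c * ‖v‖ ^ 2)
    {αbar β ι : ℝ} (hα : 0 < αbar) (hβ0 : 0 < β) (hβ1 : β < 1) (hι0 : 0 < ι) (hι1 : ι < 1)
    {z : ℕ → E} (hz : IsAcceleratedLineSearch f M R αbar β ι z) {b ρ : ℝ}
    (hb : ∀ p ∈ M, b ≤ f p) (hρ : ∀ p ∈ M, f p ≤ f (z 0) → ‖p‖ ≤ ρ) :
    (∀ t, ‖z t‖ ≤ ρ) ∧ Tendsto (fun t => ‖riemannianGradient f M (z t)‖) atTop (𝓝 0) := by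
  obtain ⟨hzM, hzd⟩ := hz
  obtain ⟨δ, hδ, hdec⟩ := exists_armijo_decrease hf hc hR hα hβ0 hβ1 hι0 hι1 ρ
  -- The constant `δ` is valid only in the ball of radius `ρ`, so descent and boundedness are
  -- propagated together.
  have hle : ∀ t, f (z t) ≤ f (z 0) := by
    intro t
    induction t with
    | zero => exact le_rfl
    | succ t ih =>
      have h1 := hdec (z t) (hzM t) (hρ _ (hzM t) ih)
      have h2 := hzd t
      have h3 : 0 ≤ δ * ‖riemannianGradient f M (z t)‖ ^ 2 := by positivity
      linarith
  have hbd : ∀ t, ‖z t‖ ≤ ρ := fun t => hρ _ (hzM t) (hle t)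
  refine ⟨hbd, ?_⟩
  have hstep : ∀ t, δ * ‖riemannianGradient f M (z t)‖ ^ 2 ≤ f (z t) - f (z (t + 1)) := fun t =>
    (hdec (z t) (hzM t) (hbd t)).trans (hzd t)
  have hsum : Summable fun t => δ * ‖riemannianGradient f M (z t)‖ ^ 2 := by
    refine summable_of_sum_range_le (c := f (z 0) - b) (fun t => by positivity) fun t => ?_
    calc _ ≤ ∑ i ∈ Finset.range t, (f (z i) - f (z (i + 1))) :=
          Finset.sum_le_sum fun i _ => hstep i
      _ = f (z 0) - f (z t) := Finset.sum_range_sub' (fun i => f (z i)) t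
      _ ≤ _ := by linarith [hb _ (hzM t)]
  have h0 := (hsum.tendsto_atTop_zero).const_mul δ⁻¹
  have h1 : Tendsto (fun t => ‖riemannianGradient f M (z t)‖ ^ 2) atTop (𝓝 0) := by
    simpa [← mul_assoc, inv_mul_cancel₀ hδ.ne'] using h0
  have h2 := (Real.continuous_sqrt.tendsto 0).comp h1
  simpa [Function.comp_def] using h2

/-- If the tangent spaces of `M` vary continuously, the set of critical points of a continuously
differentiable function is closed in the following sense. -/
theorem riemannianGradient_eq_zero_of_tendsto {f : E → ℝ} (hf : ContDiff ℝ 1 f) {M : Set E}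
    {T : E → E → E} (hT : ∀ v, Continuous fun p => T p v)
    (hTM : ∀ p ∈ M, ∀ v, T p v ∈ tangentSubspace M p)
    (hTid : ∀ p ∈ M, ∀ v ∈ tangentSubspace M p, T p v = v)
    {z : ℕ → E} (hz : ∀ t, z t ∈ M) {p : E} (hp : p ∈ M) (hzp : Tendsto z atTop (𝓝 p))
    (hg : Tendsto (fun t => ‖riemannianGradient f M (z t)‖) atTop (𝓝 0)) :
    riemannianGradient f M p = 0 := by
  have hgr : ∀ q, ∀ v ∈ tangentSubspace M q,
      inner ℝ (riemannianGradient f M q) v = fderiv ℝ f q v := fun q v hv =>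
    inner_riemannianGradient ((hf.differentiable one_ne_zero) q).hasFDerivAt.hasFDerivWithinAt hv
  set g := riemannianGradient f M p with hgdef
  have hgT : g ∈ tangentSubspace M p := riemannianGradient_mem_tangentSubspace f M p
  -- The limit gradient `g` is moved to the tangent space at `z t` by `T`. The differentials on
  -- these vectors tend both to `‖g‖²` and to `0`.
  have h1 : Tendsto (fun t => fderiv ℝ f (z t) (T (z t) g)) atTop (𝓝 (fderiv ℝ f p (T p g))) :=
    (((hf.continuous_fderiv one_ne_zero).clm_apply (hT g)).tendsto p).comp hzp
  have h2 : Tendsto (fun t => fderiv ℝ f (z t) (T (z t) g)) atTop (𝓝 0) := by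
    have h3 : Tendsto (fun t => inner ℝ (riemannianGradient f M (z t)) (T (z t) g)) atTop
        (𝓝 (inner ℝ (0 : E) (T p g))) :=
      (tendsto_zero_iff_norm_tendsto_zero.2 hg).inner (((hT g).tendsto p).comp hzp)
    rw [inner_zero_left] at h3
    exact h3.congr fun t => hgr _ _ (hTM _ (hz t) g)
  have h4 := tendsto_nhds_unique h1 h2
  rw [hTid p hp g hgT, ← hgr p g hgT] at h4
  exact inner_self_eq_zero.1 h4

end LineSearch

/-! ### Second-order estimate for the QR factor -/

section QRFactor

variable {m k : ℕ}

theorem qf_isQFactor {C : Matrix (Fin m) (Fin k) ℝ} (hC : LinearIndependent ℝ C.transpose) :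
    IsQFactor C (qf C) := by
  rw [qf, dif_pos hC]
  exact (exists_isQFactor hC).choose_spec

theorem sum_sq_eq_trace (P : Matrix (Fin m) (Fin k) ℝ) :
    ∑ i, ∑ j, P i j ^ 2 = (P.transpose * P).trace := by
  simp only [Matrix.trace, Matrix.diag_apply, Matrix.mul_apply, Matrix.transpose_apply]
  rw [Finset.sum_comm]
  simp only [sq]

/-- Cauchy–Schwarz for each pair of columns. -/
theorem sum_sq_transpose_mul_self_le (P : Matrix (Fin m) (Fin k) ℝ) :
    ∑ i, ∑ j, (P.transpose * P) i j ^ 2 ≤ (∑ i, ∑ j, P i j ^ 2) ^ 2 := by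
  rw [Finset.sum_comm (f := fun i j => P i j ^ 2), sq (∑ j, ∑ i, P i j ^ 2),
    Finset.sum_mul_sum]
  refine Finset.sum_le_sum fun i _ => Finset.sum_le_sum fun j _ => ?_
  simp only [Matrix.mul_apply, Matrix.transpose_apply]
  exact Finset.sum_mul_sq_le_sq_mul_sq _ _ _

theorem dotProduct_mulVec_self (P : Matrix (Fin m) (Fin k) ℝ) (w : Fin k → ℝ) :
    (P.mulVec w) ⬝ᵥ (P.mulVec w) = w ⬝ᵥ ((P.transpose * P).mulVec w) := by
  rw [← Matrix.mulVec_mulVec, Matrix.dotProduct_mulVec w, Matrix.vecMul_transpose]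

/-- `YᵀY` is positive semidefinite. This serves both for `C = U + Y` and for its triangular factor.
-/
theorem dotProduct_self_le_of_transpose_mul_self_eq {l : ℕ} {C : Matrix (Fin m) (Fin k) ℝ}
    {Y : Matrix (Fin l) (Fin k) ℝ} (hC : C.transpose * C = 1 + Y.transpose * Y) (w : Fin k → ℝ) :
    w ⬝ᵥ w ≤ (C.mulVec w) ⬝ᵥ (C.mulVec w) := by
  rw [dotProduct_mulVec_self, hC, Matrix.add_mulVec, dotProduct_add, Matrix.one_mulVec,
    ← dotProduct_mulVec_self]
  have h : 0 ≤ (Y.mulVec w) ⬝ᵥ (Y.mulVec w) := Finset.sum_nonneg fun i _ => mul_self_nonneg _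
  linarith

/-- Guarantees that `qf` does not take its default value `0` at `U + Y`. -/
theorem linearIndependent_of_transpose_mul_self_eq {l : ℕ} {C : Matrix (Fin m) (Fin k) ℝ}
    {Y : Matrix (Fin l) (Fin k) ℝ} (hC : C.transpose * C = 1 + Y.transpose * Y) :
    LinearIndependent ℝ C.transpose := by
  have h : LinearIndependent ℝ C.col := by
    rw [← Matrix.mulVec_injective_iff]
    intro v w hvw
    have h1 := dotProduct_self_le_of_transpose_mul_self_eq hC (v - w)
    have h2 : C.mulVec (v - w) = 0 := by
      rw [Matrix.mulVec_sub]; exact sub_eq_zero.2 hvw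
    rw [h2, dotProduct_zero] at h1
    have h3 : (v - w) ⬝ᵥ (v - w) = 0 :=
      le_antisymm h1 (Finset.sum_nonneg fun i _ => mul_self_nonneg _)
    exact sub_eq_zero.1 (dotProduct_self_eq_zero.1 h3)
  exact h

/-- The diagonal of the Cholesky factor of `1 + Yᵀ Y` is at least one. -/
theorem one_le_diag_of_transpose_mul_self_eq {l : ℕ} {R : Matrix (Fin k) (Fin k) ℝ}
    {Y : Matrix (Fin l) (Fin k) ℝ} (hR : ∀ i j, j < i → R i j = 0) (hRp : ∀ i, 0 < R i i)
    (hRY : R.transpose * R = 1 + Y.transpose * Y) (i : Fin k) : 1 ≤ R i i := by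
  have hT : R.IsUpperTriangular := fun i j hij => hR i j hij
  have hdet : IsUnit R.det := by
    rw [Matrix.det_of_isUpperTriangular hT]
    exact (Finset.prod_pos fun i _ => hRp i).ne'.isUnit
  let _ : Invertible R := Matrix.invertibleOfIsUnitDet R hdet
  have hTi : (R⁻¹).IsUpperTriangular := Matrix.blockTriangular_inv_of_blockTriangular hT
  have hmul : R * R⁻¹ = 1 := Matrix.mul_nonsing_inv R hdet
  have h1 : R i i * R⁻¹ i i = 1 := by
    have h : (R * R⁻¹) i i = 1 := by rw [hmul]; simp
    rw [Matrix.mul_apply, Finset.sum_eq_single i] at h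
    · exact h
    · intro j _ hj
      rcases lt_or_gt_of_ne hj with h | h
      · rw [hR i j h, zero_mul]
      · rw [hTi h, mul_zero]
    · simp
  -- The `i`-th column of the inverse satisfies `Rw = eᵢ`, so `‖w‖ ≤ 1`, while `w i` is the
  -- reciprocal of `R i i`.
  set w : Fin k → ℝ := fun j => R⁻¹ j i with hw
  have hRw : R.mulVec w = Pi.single i 1 := by
    ext j
    have h : (R * R⁻¹) j i = (1 : Matrix (Fin k) (Fin k) ℝ) j i := by rw [hmul]
    rw [Matrix.one_apply] at h
    rw [Pi.single_apply]
    exact h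
  have h2 := dotProduct_self_le_of_transpose_mul_self_eq hRY w
  rw [hRw] at h2
  have h3 : w i * w i ≤ w ⬝ᵥ w :=
    Finset.single_le_sum (f := fun j => w j * w j) (fun j _ => mul_self_nonneg _)
      (Finset.mem_univ i)
  have h4 : w i * w i ≤ 1 := by simpa using h3.trans h2
  have h5 : R i i * w i = 1 := h1
  have h6 := hRp i
  by_contra hlt
  push Not at hlt
  have h7 : w i ≤ 1 := by nlinarith
  nlinarith

/-- The Cholesky factor of `1 + Yᵀ Y` is close to the identity. -/
theorem sum_sq_sub_one_le_of_transpose_mul_self_eq {l : ℕ} {R : Matrix (Fin k) (Fin k) ℝ}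
    {Y : Matrix (Fin l) (Fin k) ℝ} (hR : ∀ i j, j < i → R i j = 0) (hRp : ∀ i, 0 < R i i)
    (hRY : R.transpose * R = 1 + Y.transpose * Y) :
    ∑ i, ∑ j, (R - 1) i j ^ 2 ≤ 2 * (∑ i, ∑ j, Y i j ^ 2) ^ 2 := by
  set y := ∑ i, ∑ j, Y i j ^ 2 with hy
  set E := R - 1 with hE
  set e := ∑ i, ∑ j, E i j ^ 2 with he
  have hsum : E + E.transpose = Y.transpose * Y - E.transpose * E := by
    have h : E.transpose * E = R.transpose * R - R.transpose - R + 1 := by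
      rw [hE, Matrix.transpose_sub, Matrix.transpose_one]; noncomm_ring
    rw [h, hRY, hE, Matrix.transpose_sub, Matrix.transpose_one]
    abel
  have hdiag : ∀ i, 0 ≤ E i i := fun i => by
    have := one_le_diag_of_transpose_mul_self_eq hR hRp hRY i
    rw [hE, Matrix.sub_apply, Matrix.one_apply_eq]; linarith
  have hoff : ∀ i j, j < i → E i j = 0 := fun i j h => by
    rw [hE, Matrix.sub_apply, Matrix.one_apply_ne h.ne', hR i j h, sub_zero]
  -- Taking traces in `hsum` gives `2 tr E = y - e`, and `tr E ≥ 0`.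
  have hey : e ≤ y := by
    have h := congrArg Matrix.trace hsum
    rw [Matrix.trace_add, Matrix.trace_transpose, Matrix.trace_sub (Y.transpose * Y), ← sum_sq_eq_trace,
      ← sum_sq_eq_trace] at h
    have h2 : 0 ≤ E.trace := Finset.sum_nonneg fun i _ => hdiag i
    linarith
  have he0 : 0 ≤ e := Finset.sum_nonneg fun i _ => Finset.sum_nonneg fun j _ => sq_nonneg _
  -- As `E` is upper triangular, `E` and `Eᵀ` overlap only on the diagonal, where the cross terms
  -- are squares.
  have hlow : 2 * e ≤ ∑ i, ∑ j, (E + E.transpose) i j ^ 2 := by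
    have h1 : ∑ i, ∑ j, (E + E.transpose) i j ^ 2
        = e + (∑ i, ∑ j, E j i ^ 2) + ∑ i, ∑ j, 2 * (E i j * E j i) := by
      rw [he]
      simp only [← Finset.sum_add_distrib]
      refine Finset.sum_congr rfl fun i _ => Finset.sum_congr rfl fun j _ => ?_
      rw [Matrix.add_apply, Matrix.transpose_apply]; ring
    have h2 : ∑ i, ∑ j, E j i ^ 2 = e := Finset.sum_comm
    have h3 : 0 ≤ ∑ i, ∑ j, 2 * (E i j * E j i) := by
      refine Finset.sum_nonneg fun i _ => Finset.sum_nonneg fun j _ => ?_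
      rcases lt_trichotomy i j with h | h | h
      · rw [hoff j i h]; simp
      · subst h; have := mul_self_nonneg (E i i); linarith
      · rw [hoff i j h]; simp
    linarith
  have hup : ∑ i, ∑ j, (E + E.transpose) i j ^ 2 ≤ 2 * y ^ 2 + 2 * e ^ 2 := by
    calc ∑ i, ∑ j, (E + E.transpose) i j ^ 2
        ≤ ∑ i, ∑ j, (2 * (Y.transpose * Y) i j ^ 2 + 2 * (E.transpose * E) i j ^ 2) := by
          refine Finset.sum_le_sum fun i _ => Finset.sum_le_sum fun j _ => ?_
          rw [hsum, Matrix.sub_apply]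
          nlinarith [sq_nonneg ((Y.transpose * Y) i j + (E.transpose * E) i j)]
      _ = 2 * (∑ i, ∑ j, (Y.transpose * Y) i j ^ 2) + 2 * ∑ i, ∑ j, (E.transpose * E) i j ^ 2 := by
          simp only [Finset.sum_add_distrib, Finset.mul_sum]
      _ ≤ _ := by
          gcongr
          · exact sum_sq_transpose_mul_self_le Y
          · exact sum_sq_transpose_mul_self_le E
  -- From `2e ≤ 2y² + 2e²` and `0 ≤ e ≤ y`.
  nlinarith

/-- At `U` with orthonormal columns and a tangent matrix `Y`, the factor `qf (U + Y)` has
orthonormal columns and differs from `U + Y` by a term of second order in `Y`. -/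
theorem qf_add_tangent {U Y : Matrix (Fin m) (Fin k) ℝ} (hU : U.transpose * U = 1)
    (hY : U.transpose * Y + Y.transpose * U = 0) :
    (qf (U + Y)).transpose * qf (U + Y) = 1 ∧
      ∑ i, ∑ j, (qf (U + Y) - U - Y) i j ^ 2 ≤ 2 * (∑ i, ∑ j, Y i j ^ 2) ^ 2 := by
  have hC : (U + Y).transpose * (U + Y) = 1 + Y.transpose * Y := by
    have h : (U + Y).transpose * (U + Y)
        = U.transpose * U + (U.transpose * Y + Y.transpose * U) + Y.transpose * Y := by
      rw [Matrix.transpose_add, Matrix.add_mul, Matrix.mul_add, Matrix.mul_add]; abel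
    rw [h, hU, hY, add_zero]
  obtain ⟨hQ, R, hR, hRp, hCR⟩ := qf_isQFactor (linearIndependent_of_transpose_mul_self_eq hC)
  refine ⟨hQ, ?_⟩
  set Q := qf (U + Y) with hQdef
  have hRY : R.transpose * R = 1 + Y.transpose * Y := by
    rw [← hC, hCR, Matrix.transpose_mul, Matrix.mul_assoc, ← Matrix.mul_assoc Q.transpose, hQ,
      Matrix.one_mul]
  have hdiff : Q - U - Y = -(Q * (R - 1)) := by
    rw [Matrix.mul_sub, ← hCR, Matrix.mul_one]; abel
  -- Left multiplication by `Q` preserves the Frobenius norm.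
  refine le_trans (le_of_eq ?_) (sum_sq_sub_one_le_of_transpose_mul_self_eq hR hRp hRY)
  rw [sum_sq_eq_trace, sum_sq_eq_trace, hdiff, Matrix.transpose_neg, Matrix.neg_mul,
    Matrix.mul_neg, neg_neg,
    Matrix.transpose_mul, Matrix.mul_assoc, ← Matrix.mul_assoc Q.transpose, hQ, Matrix.one_mul]

end QRFactor

/-! ### Geometry of the product of Stiefel manifolds and the cost -/

section StiefelProduct

open TripleSpace

/-- A quadratic equation that holds on `M`, linearized at a tangent vector of `M`. -/
theorem sum_mul_add_mul_eq_zero_of_mem_tangentSubspace {ι κ : Type*} [Fintype ι] [Fintype κ]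
    {M : Set (EuclideanSpace ℝ ι)} {s t : κ → ι} {c : ℝ}
    (hM : ∀ z ∈ M, ∑ i, z (s i) * z (t i) = c) {p v : EuclideanSpace ℝ ι} (hp : p ∈ M)
    (hv : v ∈ tangentSubspace M p) : ∑ i, (p (s i) * v (t i) + v (s i) * p (t i)) = 0 := by
  set f' : EuclideanSpace ℝ ι →L[ℝ] ℝ :=
    ∑ i, (p (s i) • EuclideanSpace.proj (t i) + p (t i) • EuclideanSpace.proj (s i)) with hf'
  have h1 : HasFDerivWithinAt (fun z : EuclideanSpace ℝ ι => ∑ i, z (s i) * z (t i)) f' M p := by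
    refine HasFDerivAt.hasFDerivWithinAt (HasFDerivAt.fun_sum fun i _ => ?_)
    exact ((EuclideanSpace.proj (𝕜 := ℝ) (s i)).hasFDerivAt (x := p)).mul
      ((EuclideanSpace.proj (𝕜 := ℝ) (t i)).hasFDerivAt (x := p))
  -- The function is constant on `M`, so `0` is also a derivative within `M`; the two agree on the
  -- tangent cone.
  have h2 : HasFDerivWithinAt (fun z : EuclideanSpace ℝ ι => ∑ i, z (s i) * z (t i))
      (0 : EuclideanSpace ℝ ι →L[ℝ] ℝ) M p :=
    (hasFDerivWithinAt_const c p M).congr hM (hM p hp)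
  have h3 : f' v = 0 :=
    LinearMap.eqOn_span (f := f'.toLinearMap)
      (g := (0 : EuclideanSpace ℝ ι →L[ℝ] ℝ).toLinearMap) (h1.unique_on h2) hv
  rw [hf'] at h3
  rw [← h3]
  simp [mul_comm]

variable {m n k : ℕ}

theorem TripleSpace.norm_sq_eq (z : TripleSpace m n k) :
    ‖z‖ ^ 2 = (∑ i, ∑ j, z.U i j ^ 2) + (∑ l, z.x l ^ 2) + ∑ i, ∑ j, z.V i j ^ 2 := by
  rw [EuclideanSpace.norm_sq_eq, Fintype.sum_sum_type, Fintype.sum_sum_type, Fintype.sum_prod_type,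
    Fintype.sum_prod_type]
  simp only [Real.norm_eq_abs, sq_abs, U, x, V, Matrix.of_apply, add_assoc]

theorem TripleSpace.sum_sq_nonneg (P : Matrix (Fin m) (Fin k) ℝ) : 0 ≤ ∑ i, ∑ j, P i j ^ 2 :=
  Finset.sum_nonneg fun _ _ => Finset.sum_nonneg fun _ _ => sq_nonneg _

theorem TripleSpace.continuous_U : Continuous (U : TripleSpace m n k → _) :=
  continuous_matrix fun i l => (EuclideanSpace.proj (𝕜 := ℝ) (Sum.inl (i, l))).continuous

theorem TripleSpace.continuous_V : Continuous (V : TripleSpace m n k → _) :=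
  continuous_matrix fun j l => (EuclideanSpace.proj (𝕜 := ℝ) (Sum.inr (Sum.inr (j, l)))).continuous

theorem isClosed_stiefelProduct : IsClosed (stiefelProduct m n k) :=
  (isClosed_eq ((continuous_U.matrix_transpose).matrix_mul continuous_U) continuous_const).inter
    (isClosed_eq ((continuous_V.matrix_transpose).matrix_mul continuous_V) continuous_const)

/-- The hypotheses are linear equations rather than tangency, so that the lemma can be used to
identify the tangent space. -/
theorem qrRetraction_mem_and_norm_le {p v : TripleSpace m n k} (hp : p ∈ stiefelProduct m n k)
    (hU : p.U.transpose * v.U + v.U.transpose * p.U = 0)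
    (hV : p.V.transpose * v.V + v.V.transpose * p.V = 0) :
    qrRetraction p v ∈ stiefelProduct m n k ∧ ‖qrRetraction p v - p - v‖ ≤ 2 * ‖v‖ ^ 2 := by
  obtain ⟨hU1, hU2⟩ := qf_add_tangent hp.1 hU
  obtain ⟨hV1, hV2⟩ := qf_add_tangent hp.2 hV
  refine ⟨⟨hU1, hV1⟩, abs_le_of_sq_le_sq' ?_ (by positivity) |>.2⟩
  have h1 : (qrRetraction p v - p - v).U = qf (p.U + v.U) - p.U - v.U := rfl
  have h2 : (qrRetraction p v - p - v).V = qf (p.V + v.V) - p.V - v.V := rfl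
  have h3 : ∀ l, (qrRetraction p v - p - v).x l = p.x l + v.x l - p.x l - v.x l := fun _ => rfl
  have h4 : ∑ l, (qrRetraction p v - p - v).x l ^ 2 = 0 :=
    Finset.sum_eq_zero fun l _ => by rw [h3]; ring
  rw [norm_sq_eq (qrRetraction p v - p - v), h1, h2, h4, norm_sq_eq v]
  have hx : 0 ≤ ∑ l, v.x l ^ 2 := Finset.sum_nonneg fun _ _ => sq_nonneg _
  have hu := sum_sq_nonneg v.U
  have hv := sum_sq_nonneg v.V
  nlinarith [mul_nonneg hu hx, mul_nonneg hv hx, mul_nonneg hu hv]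

/-- Differentiating the orthonormality relations gives one direction; in the other, the retraction
itself supplies a curve with velocity `v`. -/
theorem mem_tangentSubspace_stiefelProduct {p v : TripleSpace m n k}
    (hp : p ∈ stiefelProduct m n k) :
    v ∈ tangentSubspace (stiefelProduct m n k) p ↔
      p.U.transpose * v.U + v.U.transpose * p.U = 0 ∧
        p.V.transpose * v.V + v.V.transpose * p.V = 0 := by
  constructor
  · intro hv
    constructor
    · ext a b
      have h := sum_mul_add_mul_eq_zero_of_mem_tangentSubspace
        (s := fun i => Sum.inl (i, a)) (t := fun i => Sum.inl (i, b))
        (c := (1 : Matrix (Fin k) (Fin k) ℝ) a b) (fun z hz => by rw [← hz.1]; rfl) hp hv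
      rw [Finset.sum_add_distrib] at h
      exact h
    · ext a b
      have h := sum_mul_add_mul_eq_zero_of_mem_tangentSubspace
        (s := fun i => Sum.inr (Sum.inr (i, a))) (t := fun i => Sum.inr (Sum.inr (i, b)))
        (c := (1 : Matrix (Fin k) (Fin k) ℝ) a b) (fun z hz => by rw [← hz.2]; rfl) hp hv
      rw [Finset.sum_add_distrib] at h
      exact h
  · rintro ⟨hU, hV⟩
    have h : ∀ t : ℝ, qrRetraction p (t • v) ∈ stiefelProduct m n k ∧
        ‖qrRetraction p (t • v) - p - t • v‖ ≤ 2 * ‖t • v‖ ^ 2 := by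
      intro t
      refine qrRetraction_mem_and_norm_le hp ?_ ?_
      · have h1 : (t • v).U = t • v.U := rfl
        rw [h1, Matrix.transpose_smul, Matrix.mul_smul, Matrix.smul_mul, ← smul_add, hU, smul_zero]
      · have h1 : (t • v).V = t • v.V := rfl
        rw [h1, Matrix.transpose_smul, Matrix.mul_smul, Matrix.smul_mul, ← smul_add, hV, smul_zero]
    exact mem_tangentSubspace_of_retraction (R := qrRetraction p) (fun t => (h t).1)
      fun t => (h t).2

/-- The orthogonal projection onto the tangent space of the Stiefel manifold at `X`. -/
def stiefelTangentProj (X Y : Matrix (Fin m) (Fin k) ℝ) : Matrix (Fin m) (Fin k) ℝ :=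
  Y - X * ((1 / 2 : ℝ) • (X.transpose * Y + Y.transpose * X))

theorem stiefelTangentProj_tangent {X : Matrix (Fin m) (Fin k) ℝ} (hX : X.transpose * X = 1)
    (Y : Matrix (Fin m) (Fin k) ℝ) :
    X.transpose * stiefelTangentProj X Y + (stiefelTangentProj X Y).transpose * X = 0 := by
  have hS : (X.transpose * Y + Y.transpose * X).transpose
      = X.transpose * Y + Y.transpose * X := by
    simp [Matrix.transpose_add, Matrix.transpose_mul, add_comm]
  rw [stiefelTangentProj, Matrix.transpose_sub, Matrix.transpose_mul, Matrix.transpose_smul, hS,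
    Matrix.mul_sub, Matrix.sub_mul, ← Matrix.mul_assoc, hX, Matrix.one_mul, Matrix.mul_assoc, hX,
    Matrix.mul_one]
  set S := X.transpose * Y + Y.transpose * X with hSdef
  have h : (1 / 2 : ℝ) • S + (1 / 2 : ℝ) • S = S := by rw [← add_smul]; norm_num
  calc _ = (X.transpose * Y + Y.transpose * X) - ((1 / 2 : ℝ) • S + (1 / 2 : ℝ) • S) := by abel
    _ = 0 := by rw [h, hSdef, sub_self]

theorem stiefelTangentProj_eq_self {X Y : Matrix (Fin m) (Fin k) ℝ}
    (h : X.transpose * Y + Y.transpose * X = 0) : stiefelTangentProj X Y = Y := by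
  rw [stiefelTangentProj, h, smul_zero, Matrix.mul_zero, sub_zero]

theorem continuous_stiefelTangentProj (Y : Matrix (Fin m) (Fin k) ℝ) :
    Continuous fun X => stiefelTangentProj X Y := by
  unfold stiefelTangentProj
  fun_prop

/-- The orthogonal projection onto the tangent space of `stiefelProduct m n k` at `p`. -/
def stiefelProductTangentProj (p v : TripleSpace m n k) : TripleSpace m n k :=
  mk (stiefelTangentProj p.U v.U) v.x (stiefelTangentProj p.V v.V)

theorem continuous_stiefelProductTangentProj (v : TripleSpace m n k) :
    Continuous fun p => stiefelProductTangentProj p v := by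
  have hU : Continuous fun p : TripleSpace m n k => stiefelTangentProj p.U v.U :=
    (continuous_stiefelTangentProj v.U).comp continuous_U
  have hV : Continuous fun p : TripleSpace m n k => stiefelTangentProj p.V v.V :=
    (continuous_stiefelTangentProj v.V).comp continuous_V
  refine (PiLp.continuous_toLp 2 _).comp (continuous_pi fun i => ?_)
  rcases i with ⟨i, l⟩ | l | ⟨j, l⟩
  · exact hU.matrix_elem i l
  · exact continuous_const
  · exact hV.matrix_elem j l

theorem costG_eq (A W : Matrix (Fin m) (Fin n) ℝ) (lam : ℝ) (z : TripleSpace m n k) :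
    costG A W lam z =
      (∑ i, ∑ j, W i j * (A i j - (z.U * Matrix.diagonal z.x * z.V.transpose) i j) ^ 2) +
        lam * ∑ i, ∑ j, (z.U * Matrix.diagonal z.x * z.V.transpose) i j ^ 2 := by
  rw [costG, costF, frobNorm, Real.sq_sqrt (sum_sq_nonneg _)]

theorem contDiff_costG (A W : Matrix (Fin m) (Fin n) ℝ) (lam : ℝ) {r : WithTop ℕ∞} :
    ContDiff ℝ r (costG (k := k) A W lam) := by
  have hP : ∀ i j, ContDiff ℝ r fun z : TripleSpace m n k =>
      (z.U * Matrix.diagonal z.x * z.V.transpose) i j := by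
    intro i j
    have h : ∀ z : TripleSpace m n k, (z.U * Matrix.diagonal z.x * z.V.transpose) i j
        = ∑ l, z (Sum.inl (i, l)) * z (Sum.inr (Sum.inl l)) * z (Sum.inr (Sum.inr (j, l))) := by
      intro z
      rw [Matrix.mul_apply]
      exact Finset.sum_congr rfl fun l _ => by rw [Matrix.mul_diagonal]; rfl
    simp only [h]
    fun_prop
  rw [funext (costG_eq A W lam)]
  refine ContDiff.add (ContDiff.sum fun i _ => ContDiff.sum fun j _ => ?_)
    (contDiff_const.mul (ContDiff.sum fun i _ => ContDiff.sum fun j _ => (hP i j).pow 2))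
  exact contDiff_const.mul ((contDiff_const.sub (hP i j)).pow 2)

/-- Under the trace, `UᵀU` and `VᵀV` cancel by cyclicity. -/
theorem sum_sq_mul_diagonal_mul_transpose {p : TripleSpace m n k}
    (hp : p ∈ stiefelProduct m n k) :
    ∑ i, ∑ j, (p.U * Matrix.diagonal p.x * p.V.transpose) i j ^ 2 = ∑ l, p.x l ^ 2 := by
  have hU : p.U.transpose * p.U = 1 := hp.1
  have hV : p.V.transpose * p.V = 1 := hp.2
  rw [sum_sq_eq_trace, Matrix.transpose_mul, Matrix.transpose_mul, Matrix.transpose_transpose,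
    Matrix.mul_assoc, Matrix.trace_mul_comm, Matrix.diagonal_transpose]
  have h : Matrix.diagonal p.x * p.U.transpose * (p.U * Matrix.diagonal p.x * p.V.transpose) * p.V
      = Matrix.diagonal p.x * ((p.U.transpose * p.U) * Matrix.diagonal p.x)
        * (p.V.transpose * p.V) := by
    simp only [Matrix.mul_assoc]
  rw [h, hU, hV, Matrix.one_mul, Matrix.mul_one, Matrix.diagonal_mul_diagonal,
    Matrix.trace_diagonal]
  simp only [sq]

theorem sum_sq_of_mem_stiefel {X : Matrix (Fin m) (Fin k) ℝ} (hX : X ∈ stiefel m k) :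
    ∑ i, ∑ j, X i j ^ 2 = k := by
  rw [sum_sq_eq_trace, show X.transpose * X = 1 from hX]
  simp

/-- The regularizer alone controls `x`, the only unbounded component of `M`. -/
theorem mul_sum_sq_le_costG {A W : Matrix (Fin m) (Fin n) ℝ} (hW : ∀ i j, 0 ≤ W i j) (lam : ℝ)
    {p : TripleSpace m n k} (hp : p ∈ stiefelProduct m n k) :
    lam * ∑ l, p.x l ^ 2 ≤ costG A W lam p := by
  rw [costG_eq, sum_sq_mul_diagonal_mul_transpose hp]
  have h : 0 ≤ ∑ i, ∑ j,
      W i j * (A i j - (p.U * Matrix.diagonal p.x * p.V.transpose) i j) ^ 2 :=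
    Finset.sum_nonneg fun i _ => Finset.sum_nonneg fun j _ => mul_nonneg (hW i j) (sq_nonneg _)
  linarith

end StiefelProduct

end

/-! ### The convergence theorem -/

theorem propositionC1 {m n k : ℕ} (hk : 0 < k) (hkm : k ≤ m) (hkn : k ≤ n)
    (A W : Matrix (Fin m) (Fin n) ℝ) (hW : ∀ i j, 0 ≤ W i j) (hWsum : ∑ i, ∑ j, W i j = 1)
    (lam : ℝ) (hlam : 0 < lam)
    (αbar β ι : ℝ) (hα : 0 < αbar) (hβ0 : 0 < β) (hβ1 : β < 1) (hι0 : 0 < ι) (hι1 : ι < 1)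
    (z : ℕ → TripleSpace m n k)
    (hz : IsAcceleratedLineSearch (costG A W lam) (stiefelProduct m n k) qrRetraction αbar β ι z) :
    Tendsto (fun t => ‖riemannianGradient (costG A W lam) (stiefelProduct m n k) (z t)‖)
        atTop (𝓝 0) ∧
      ∃ (φ : ℕ → ℕ) (p : TripleSpace m n k),
        StrictMono φ ∧ Tendsto (z ∘ φ) atTop (𝓝 p) ∧ p ∈ stiefelProduct m n k ∧
          riemannianGradient (costG A W lam) (stiefelProduct m n k) p = 0 := by
  have hR : ∀ p ∈ stiefelProduct m n k, ∀ v ∈ tangentSubspace (stiefelProduct m n k) p,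
      ‖qrRetraction p v - p - v‖ ≤ 2 * ‖v‖ ^ 2 := fun p hp v hv =>
    have h := (mem_tangentSubspace_stiefelProduct hp).1 hv
    (qrRetraction_mem_and_norm_le hp h.1 h.2).2
  have hb : ∀ p ∈ stiefelProduct m n k, 0 ≤ costG A W lam p := fun p hp =>
    le_trans (mul_nonneg hlam.le (Finset.sum_nonneg fun _ _ => sq_nonneg _))
      (mul_sum_sq_le_costG hW lam hp)
  set c := costG A W lam (z 0) with hc
  -- Each orthonormal factor contributes `k` to the squared norm, and `x` at most `c / lam`.
  have hρ : ∀ p ∈ stiefelProduct m n k, costG A W lam p ≤ c →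
      ‖p‖ ≤ Real.sqrt (k + c / lam + k) := by
    intro p hp hpc
    refine Real.le_sqrt_of_sq_le ?_
    rw [TripleSpace.norm_sq_eq, sum_sq_of_mem_stiefel hp.1, sum_sq_of_mem_stiefel hp.2]
    have h : ∑ l, p.x l ^ 2 ≤ c / lam := by
      rw [le_div_iff₀ hlam, mul_comm]
      exact (mul_sum_sq_le_costG hW lam hp).trans hpc
    linarith
  obtain ⟨hbd, hlim⟩ := hz.bounded_and_tendsto (contDiff_costG A W lam) zero_le_two hR hα hβ0 hβ1
    hι0 hι1 hb hρ
  refine ⟨hlim, ?_⟩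
  obtain ⟨p, -, φ, hφ, hp⟩ := (isCompact_closedBall (0 : TripleSpace m n k) _).tendsto_subseq
    fun t => mem_closedBall_zero_iff.2 (hbd t)
  have hpM : p ∈ stiefelProduct m n k :=
    isClosed_stiefelProduct.mem_of_tendsto hp (Eventually.of_forall fun t => hz.1 (φ t))
  refine ⟨φ, p, hφ, hp, hpM, ?_⟩
  refine riemannianGradient_eq_zero_of_tendsto (contDiff_costG A W lam)
    (T := stiefelProductTangentProj) continuous_stiefelProductTangentProj ?_ ?_
    (fun t => hz.1 (φ t)) hpM hp (hlim.comp hφ.tendsto_atTop)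
  · intro q hq v
    exact (mem_tangentSubspace_stiefelProduct hq).2
      ⟨stiefelTangentProj_tangent hq.1 v.U, stiefelTangentProj_tangent hq.2 v.V⟩
  · intro q hq v hv
    obtain ⟨hU, hV⟩ := (mem_tangentSubspace_stiefelProduct hq).1 hv
    rw [stiefelProductTangentProj, stiefelTangentProj_eq_self hU, stiefelTangentProj_eq_self hV]
    ext i
    rcases i with ⟨i, l⟩ | l | ⟨j, l⟩ <;> rfl
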